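/- Let $D,R$ be finite sets. A $D$-way branching program on $n$ inputs is a finite directed acyclic multigraph with a source node, in which every non-sink node is labeled by an input index in $\{1,\dots,n\}$ and has exactly one out-edge labeled by each element of $D$, and every sink is labeled by an element of $R$; on input $x\in D^n$ it starts at the source, follows at each node the edge labeled by the value of the queried input, and outputs the label of the sink it reaches. Its size is its number of nodes, its space is $S=\log_2(\text{size})$, and its time is the length of a longest path from the source to a sink. It is oblivious if the sequence of input indices queried is the same along every path from the source to a sink. MedianBit is the low-order bit of the median of $n$ integers from $[2n]=\{1,\dots,2n\}$, where the median is the $\lceil n/2\rceil$-th smallest of them (the statement holds equally with "$\lceil n/2\rceil$-th largest"). Theorem. There are absolute constants $c>0$, $a\in\mathbb N$ and $C\in\mathbb{R}$ such that for every $n\ge 2$ the following holds for every oblivious $2n$-way branching program that computes MedianBit for $n$ inputs from $[2n]$ (it suffices that its output is correct on all inputs consisting of $n$ distinct integers) in time at most $T$. (1) For every real $k$ with $T\le kn$, the program has size at least $$2^{\,c\,n^{1/2^{4k+2}}/(\log_2 n)^a},$$ that is, size at least $2^{\tilde\Omega\left(n^{1/2^{4k+2}}\right)}$, where $\tilde\Omega$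 hides factors polylogarithmic in $n$. (2) If $S$ is the space of the program, then $$T\ \ge\ 0.25\,n\log_2\log_S n-C\,n .$$ -/

import Mathlib

/-- A `D`-way branching program on `n` inputs from `D` with outputs in `R`: a finite directed
acyclic multigraph. A node `v` with `kind v = Sum.inl (i, next)` is a non-sink node querying input
`i`, with exactly one out-edge, to `next d`, for each `d : D`; a node with `kind v = Sum.inr r` is
a sink labelled `r`. Nodes that cannot be reached from the source are not excluded; they only
count towards the size. -/
structure BranchingProgram (n : ℕ) (D R : Type) where
  Node : Type
  [fintypeNode : Fintype Node]
  source : Node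
  kind : Node → (Fin n × (D → Node)) ⊕ R
  acyclic : ∀ v : Node, ¬ Relation.TransGen
    (fun u w => ∃ (i : Fin n) (next : D → Node) (d : D),
      kind u = Sum.inl (i, next) ∧ next d = w) v v

attribute [instance] BranchingProgram.fintypeNode

namespace BranchingProgram

variable {n : ℕ} {D R : Type}

/-- `B.Path u l w`: there is a directed path in the graph of `B` from `u` to `w` along which
the successively queried input indices form the list `l` (so `l.length` is its length). -/
inductive Path (B : BranchingProgram n D R) : B.Node → List (Fin n) → B.Node → Prop
  | nil (v : B.Node) : Path B v [] v
  | cons {u w : B.Node} {i : Fin n} {next : D → B.Node} {l : List (Fin n)} (d : D)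
      (hu : B.kind u = Sum.inl (i, next)) (h : Path B (next d) l w) : Path B u (i :: l) w

/-- `B.OutputsFrom x v r`: started at node `v` on input `x`, following at each node the edge
given by the queried input value, `B` reaches a sink labelled `r`. -/
inductive OutputsFrom (B : BranchingProgram n D R) (x : Fin n → D) : B.Node → R → Prop
  | sink {v : B.Node} {r : R} (hv : B.kind v = Sum.inr r) : OutputsFrom B x v r
  | query {v : B.Node} {i : Fin n} {next : D → B.Node} {r : R}
      (hv : B.kind v = Sum.inl (i, next)) (h : OutputsFrom B x (next (x i)) r) :
      OutputsFrom B x v r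

/-- On input `x` the program outputs `r`. -/
def Outputs (B : BranchingProgram n D R) (x : Fin n → D) (r : R) : Prop :=
  B.OutputsFrom x B.source r

/-- `v` is a sink. -/
def IsSink (B : BranchingProgram n D R) (v : B.Node) : Prop :=
  ∃ r : R, B.kind v = Sum.inr r

/-- The same sequence of input indices is queried along every path from the source to a sink. -/
def Oblivious (B : BranchingProgram n D R) : Prop :=
  ∃ s : List (Fin n), ∀ (l : List (Fin n)) (v : B.Node),
    B.IsSink v → B.Path B.source l v → l = s

/-- `B` runs in time at most `T`: every path from the source to a sink has length at most `T`. -/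
def RunsInTime (B : BranchingProgram n D R) (T : ℕ) : Prop :=
  ∀ (l : List (Fin n)) (v : B.Node), B.IsSink v → B.Path B.source l v → l.length ≤ T

/-- The size is the number of nodes. -/
def size (B : BranchingProgram n D R) : ℕ := Fintype.card B.Node

/-- The space is the base-two logarithm of the size. -/
noncomputable def space (B : BranchingProgram n D R) : ℝ := Real.logb 2 (B.size : ℝ)

end BranchingProgram

/-- The set `[m] = {1, …, m}`. -/
abbrev UpTo (m : ℕ) : Type := {v : ℕ // 1 ≤ v ∧ v ≤ m}

/-- The `r`-th smallest (with multiplicity) of the numbers `x 0, …, x (n - 1)`, for `1 ≤ r ≤ n`: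
the least `v` such that at least `r` of these numbers are at most `v`. -/
noncomputable def orderStatistic {n m : ℕ} (r : ℕ) (x : Fin n → UpTo m) : ℕ :=
  sInf {v : ℕ | r ≤ (Finset.univ.filter fun i : Fin n => (x i : ℕ) ≤ v).card}

/-- `r` is a median rank of `n` numbers: the `r`-th smallest of them is the `⌈n/2⌉`-th smallest
or the `⌈n/2⌉`-th largest (the two usual conventions, which differ only for even `n`). -/
def IsMedianRank (n r : ℕ) : Prop := r = (n + 1) / 2 ∨ r = n / 2 + 1

/-- The low-order bit of the median of `x 0, …, x (n - 1)`, the median being the `r`-th smallest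
for the median rank `r`. -/
noncomputable def medianBit {n m : ℕ} (r : ℕ) (x : Fin n → UpTo m) : Bool :=
  (orderStatistic r x).testBit 0

/-! The proof is a communication argument. In time `k n`, more than half of the indices are queried
at most `K = ⌊2k⌋` times each. Splitting these in two and repeatedly halving yields large disjoint
sets `X`, `Y` of positions for which the fixed query sequence falls into `2K + 1` blocks, each
avoiding `X` or avoiding `Y` (`exists_splitsInto`). Let one party hold the inputs at `X`, the other
those at `Y`. A block that avoids one set can be simulated by the other party alone, who announces
the node reached. A program of size `N` thus becomes a protocol with `d = 4K + 2` alternating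
messages over `N` letters (`BranchingProgram.rounds_of_splitsInto`).

Against this stands a pointer-chasing function that is hard for `d` messages. At each level one
party holds a pointer into `b` copies of the previous problem with exchanged roles, and the party
without the pointer must speak first. That message fixes too little about most copies to be useful,
so a round can be removed (`RoundHard.step`).

Pointer chasing embeds into the median: the copies are stacked in consecutive intervals, and the
pointer holder adds small and large numbers that move the median into the chosen interval
(`MedianEncoding.step`). Each level multiplies the width by `3b`, with `b` proportional to `log N`.
Hence about `(log N)^d` positions, up to a factor exponential in `d`, suffice for the reduction, and
`log N` is at least of order `n^(1/(2d))`. This exceeds the claimed bound because `2d ≤ 2^(4k+2)`;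
no logarithmic factor is lost. The time bound follows by taking `k = T/n` and two logarithms. -/

/-! ### Query sequences with few alternations. -/

/-- The list `l` splits into `r` consecutive blocks each of which avoids `X` or avoids `Y`. -/
inductive SplitsInto {α : Type*} (X Y : Finset α) : ℕ → List α → Prop
  | nil : SplitsInto X Y 0 []
  | left {r : ℕ} {l₁ l₂ : List α} (h : ∀ i ∈ l₁, i ∉ X) (h₂ : SplitsInto X Y r l₂) :
      SplitsInto X Y (r + 1) (l₁ ++ l₂)
  | right {r : ℕ} {l₁ l₂ : List α} (h : ∀ i ∈ l₁, i ∉ Y) (h₂ : SplitsInto X Y r l₂) :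
      SplitsInto X Y (r + 1) (l₁ ++ l₂)

namespace SplitsInto

variable {α : Type*} {X Y : Finset α}

theorem pad {r : ℕ} {l : List α} (h : SplitsInto X Y r l) : SplitsInto X Y (r + 1) l :=
  left (l₁ := []) (by simp) h

theorem mono {r s : ℕ} {l : List α} (hrs : r ≤ s) (h : SplitsInto X Y r l) :
    SplitsInto X Y s l := by
  induction hrs with
  | refl => exact h
  | step _ ih => exact ih.pad

theorem symm {r : ℕ} {l : List α} (h : SplitsInto X Y r l) : SplitsInto Y X r l := by
  induction h with
  | nil => exact nil
  | left h _ ih => exact right h ih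
  | right h _ ih => exact left h ih

theorem subset {X' Y' : Finset α} (hX : X' ⊆ X) (hY : Y' ⊆ Y) {r : ℕ} {l : List α}
    (h : SplitsInto X Y r l) : SplitsInto X' Y' r l := by
  induction h with
  | nil => exact nil
  | left h _ ih => exact left (fun i hi hx => h i hi (hX hx)) ih
  | right h _ ih => exact right (fun i hi hx => h i hi (hY hx)) ih

theorem single_left {l : List α} (h : ∀ i ∈ l, i ∉ X) : SplitsInto X Y 1 l := by
  simpa using left h (nil (X := X) (Y := Y))

end SplitsInto

/-- Cut a list at the first moment at which half of `X` or half of `Y` has occurred. -/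
theorem exists_halving_prefix {α : Type*} [DecidableEq α] (X Y : Finset α) (hd : Disjoint X Y)
    (s : List α) :
    (2 * (X.filter (· ∈ s)).card ≤ X.card ∧ 2 * (Y.filter (· ∈ s)).card ≤ Y.card) ∨
    ∃ l₁ l₂, s = l₁ ++ l₂ ∧
      ((X.card ≤ 2 * (X.filter (· ∈ l₁)).card ∧ 2 * (Y.filter (· ∈ l₁)).card ≤ Y.card) ∨
       (Y.card ≤ 2 * (Y.filter (· ∈ l₁)).card ∧ 2 * (X.filter (· ∈ l₁)).card ≤ X.card)) := by
  induction s using List.reverseRecOn with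
  | nil => left; simp
  | append_singleton s e ih =>
    rcases ih with ⟨hX, hY⟩ | ⟨l₁, l₂, rfl, h⟩
    · have key : ∀ Z : Finset α, e ∉ Z →
          Z.filter (· ∈ s ++ [e]) = Z.filter (· ∈ s) := by
        intro Z he
        refine Finset.filter_congr fun x hx => ?_
        have : x ≠ e := fun h => he (h ▸ hx)
        simp [this]
      by_cases hb : 2 * (X.filter (· ∈ s ++ [e])).card ≤ X.card ∧
          2 * (Y.filter (· ∈ s ++ [e])).card ≤ Y.card
      · exact Or.inl hb
      · refine Or.inr ⟨s ++ [e], [], by simp, ?_⟩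
        by_cases heX : e ∈ X
        · rw [key Y (Finset.disjoint_left.1 hd heX)] at hb ⊢
          left; constructor <;> omega
        · rw [key X heX] at hb ⊢
          right; constructor <;> omega
    · exact Or.inr ⟨l₁, l₂ ++ [e], by simp, h⟩

/-- If few occurrences are allowed per element, large subsets of `X` and `Y` occur in few
alternating blocks. -/
theorem exists_splitsInto {α : Type*} [DecidableEq α] (K : ℕ) :
    ∀ (s : List α) (X Y : Finset α), Disjoint X Y →
      (∀ x ∈ X, ∀ y ∈ Y, s.count x + s.count y ≤ K) →
      ∃ X' ⊆ X, ∃ Y' ⊆ Y, X.card ≤ 2 ^ K * X'.card ∧ Y.card ≤ 2 ^ K * Y'.card ∧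
        SplitsInto X' Y' (K + 1) s := by
  induction K with
  | zero =>
    intro s X Y _ hc
    refine ⟨X, subset_rfl, Y, subset_rfl, by simp, by simp, ?_⟩
    by_cases hX : ∃ x, x ∈ X
    · obtain ⟨x, hx⟩ := hX
      refine (SplitsInto.single_left fun i hi hY => ?_).symm
      have := hc x hx i hY
      have := List.count_pos_iff.2 hi
      omega
    · exact SplitsInto.single_left fun i _ hx => hX ⟨i, hx⟩
  | succ K ih =>
    intro s X Y hd hc
    have compl : ∀ (Z : Finset α) (l : List α), 2 * (Z.filter (· ∈ l)).card ≤ Z.card →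
        Z.card ≤ 2 * (Z.filter (· ∉ l)).card := by
      intro Z l h
      have := Finset.card_filter_add_card_filter_not (s := Z) (· ∈ l)
      omega
    have step : ∀ (X Y : Finset α), Disjoint X Y →
        (∀ x ∈ X, ∀ y ∈ Y, s.count x + s.count y ≤ K + 1) → ∀ l₁ l₂, s = l₁ ++ l₂ →
        X.card ≤ 2 * (X.filter (· ∈ l₁)).card → 2 * (Y.filter (· ∈ l₁)).card ≤ Y.card →
        ∃ X' ⊆ X, ∃ Y' ⊆ Y, X.card ≤ 2 ^ (K + 1) * X'.card ∧ Y.card ≤ 2 ^ (K + 1) * Y'.card ∧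
          SplitsInto X' Y' (K + 2) s := by
      intro X Y hd hc l₁ l₂ hs h1 h2
      -- Keep the part of `X` seen in `l₁` and the part of `Y` not seen there. Then `l₁` is one
      -- block avoiding `Y'`, and each kept element of `X` has spent an occurrence, so the budget on
      -- `l₂` drops to `K`.
      obtain ⟨X', hX', Y', hY', h3, h4, h5⟩ := ih l₂ (X.filter (· ∈ l₁)) (Y.filter (· ∉ l₁))
        (Finset.disjoint_filter_filter hd) (by
          intro x hx y hy
          rw [Finset.mem_filter] at hx hy
          have := hc x hx.1 y hy.1
          have := List.count_pos_iff.2 hx.2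
          rw [hs, List.count_append, List.count_append] at *
          omega)
      have h2' := compl Y l₁ h2
      refine ⟨X', hX'.trans (Finset.filter_subset _ _), Y', hY'.trans (Finset.filter_subset _ _),
        ?_, ?_, ?_⟩
      · rw [pow_succ]; linarith
      · rw [pow_succ]; linarith
      · rw [hs]
        exact SplitsInto.right (fun i hi hy => (Finset.mem_filter.1 (hY' hy)).2 hi) h5
    rcases exists_halving_prefix X Y hd s with ⟨hX, hY⟩ | ⟨l₁, l₂, hs, ⟨h1, h2⟩ | ⟨h1, h2⟩⟩
    · have h1 := compl X s hX
      have h2 := compl Y s hY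
      have hp : 1 ≤ 2 ^ K := Nat.one_le_two_pow
      refine ⟨X.filter (· ∉ s), Finset.filter_subset _ _, Y.filter (· ∉ s),
        Finset.filter_subset _ _, ?_, ?_, ?_⟩
      · rw [pow_succ]; nlinarith
      · rw [pow_succ]; nlinarith
      · refine SplitsInto.mono (r := 1) (by omega) (SplitsInto.single_left fun i hi hx => ?_)
        exact (Finset.mem_filter.1 hx).2 hi
    · exact step X Y hd hc l₁ l₂ hs h1 h2
    · obtain ⟨Y', hY', X', hX', h3, h4, h5⟩ := step Y X hd.symm
        (fun y hy x hx => by rw [add_comm]; exact hc x hx y hy) l₁ l₂ hs h1 h2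
      exact ⟨X', hX', Y', hY', h4, h3, h5.symm⟩

/-! ### Alternating protocols and their extraction from programs. -/

/-- `f` restricted to `EA × EB` is determined by `d` messages from `Q`, sent alternately by the two
parties, the holder of the second argument being the first to speak. -/
def Rounds (Q : Type) : ℕ → {A B : Type} → Finset A → Finset B → (A → B → Bool) → Prop
  | 0, _, _, EA, EB, f => ∃ c, ∀ a ∈ EA, ∀ b ∈ EB, f a b = c
  | d + 1, _, B, EA, EB, f => ∃ m : B → Q, ∀ q,
      Rounds Q d (by classical exact EB.filter fun b => m b = q) EA (fun b a => f a b)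

theorem Rounds.comap {Q : Type} (d : ℕ) : ∀ {A B A' B' : Type} {EA : Finset A} {EB : Finset B}
    {EA' : Finset A'} {EB' : Finset B'} {f : A → B → Bool} (φ : A' → A) (ψ : B' → B),
    (∀ a ∈ EA', φ a ∈ EA) → (∀ b ∈ EB', ψ b ∈ EB) → Rounds Q d EA EB f →
    Rounds Q d EA' EB' (fun a b => f (φ a) (ψ b)) := by
  induction d with
  | zero =>
    rintro A B A' B' EA EB EA' EB' f φ ψ hA hB ⟨c, hc⟩
    exact ⟨c, fun a ha b hb => hc _ (hA a ha) _ (hB b hb)⟩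
  | succ d ih =>
    rintro A B A' B' EA EB EA' EB' f φ ψ hA hB ⟨m, hm⟩
    refine ⟨fun b => m (ψ b), fun q => ?_⟩
    refine ih ψ φ (fun b hb => ?_) hA (hm q)
    simp only [Finset.mem_filter] at hb ⊢
    exact ⟨hB b hb.1, hb.2⟩

theorem Rounds.congr {Q : Type} {d : ℕ} : ∀ {A B : Type} {EA : Finset A} {EB : Finset B}
    {f f' : A → B → Bool}, Rounds Q d EA EB f → (∀ a ∈ EA, ∀ b ∈ EB, f a b = f' a b) →
    Rounds Q d EA EB f' := by
  induction d with
  | zero =>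
    rintro A B EA EB f f' ⟨c, hc⟩ h
    exact ⟨c, fun a ha b hb => (h a ha b hb).symm.trans (hc a ha b hb)⟩
  | succ d ih =>
    rintro A B EA EB f f' ⟨m, hm⟩ h
    refine ⟨m, fun q => ih (hm q) fun b hb a ha => h a ha b ?_⟩
    simp only [Finset.mem_filter] at hb
    exact hb.1

namespace BranchingProgram

variable {n : ℕ} {D R : Type} (B : BranchingProgram n D R)

/-- On input `x`, started at `v`, the program queries the indices `l` and reaches `w`. -/
def Reach (x : Fin n → D) : List (Fin n) → B.Node → B.Node → Prop
  | [], v, w => v = w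
  | i :: l, v, w => ∃ next, B.kind v = Sum.inl (i, next) ∧ Reach x l (next (x i)) w

/-- On input `x`, started at `v`, the program queries exactly the indices `l` and outputs `r`. -/
def Follows (x : Fin n → D) (l : List (Fin n)) (v : B.Node) (r : R) : Prop :=
  ∃ w, B.Reach x l v w ∧ B.kind w = Sum.inr r

variable {B}

theorem Reach.unique {x : Fin n → D} {l : List (Fin n)} : ∀ {v w w' : B.Node},
    B.Reach x l v w → B.Reach x l v w' → w = w' := by
  induction l with
  | nil => rintro v w w' rfl h; exact h
  | cons i l ih =>
    rintro v w w' ⟨nx, h1, h2⟩ ⟨nx', h1', h2'⟩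
    rw [h1] at h1'
    obtain rfl : nx = nx' := by simpa using h1'
    exact ih h2 h2'

theorem Reach.congr {x y : Fin n → D} {l : List (Fin n)} : ∀ {v w : B.Node},
    (∀ i ∈ l, x i = y i) → B.Reach x l v w → B.Reach y l v w := by
  induction l with
  | nil => intro v w _ h; exact h
  | cons i l ih =>
    rintro v w hxy ⟨nx, h1, h2⟩
    refine ⟨nx, h1, ?_⟩
    rw [← hxy i (by simp)]
    exact ih (fun j hj => hxy j (by simp [hj])) h2

theorem reach_append {x : Fin n → D} {l₁ l₂ : List (Fin n)} : ∀ {v w : B.Node},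
    B.Reach x (l₁ ++ l₂) v w → ∃ u, B.Reach x l₁ v u ∧ B.Reach x l₂ u w := by
  induction l₁ with
  | nil => intro v w h; exact ⟨v, rfl, h⟩
  | cons i l ih =>
    rintro v w ⟨nx, h1, h2⟩
    obtain ⟨u, h3, h4⟩ := ih h2
    exact ⟨u, ⟨nx, h1, h3⟩, h4⟩

theorem Reach.path {x : Fin n → D} {l : List (Fin n)} : ∀ {v w : B.Node},
    B.Reach x l v w → B.Path v l w := by
  induction l with
  | nil => rintro v w rfl; exact Path.nil _
  | cons i l ih =>
    rintro v w ⟨nx, h1, h2⟩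
    exact Path.cons _ h1 (ih h2)

theorem OutputsFrom.exists_follows {x : Fin n → D} {v : B.Node} {r : R}
    (h : B.OutputsFrom x v r) : ∃ l, B.Follows x l v r := by
  induction h with
  | sink hv => exact ⟨[], _, rfl, hv⟩
  | query hv _ ih =>
    obtain ⟨l, w, h1, h2⟩ := ih
    exact ⟨_ :: l, w, ⟨_, hv, h1⟩, h2⟩

/-- A program whose queries split into `r` blocks gives a protocol with `2 * r` messages. -/
theorem rounds_of_splitsInto {B : BranchingProgram n D Bool} {X Y : Finset (Fin n)} {r : ℕ}
    {l : List (Fin n)} (hs : SplitsInto X Y r l) {α β : Type} (z : α → β → Fin n → D)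
    (hX : ∀ a a' b i, i ∉ X → z a b i = z a' b i)
    (hY : ∀ a b b' i, i ∉ Y → z a b i = z a b' i) (f : α → β → Bool) :
    ∀ (v : B.Node) (EA : Finset α) (EB : Finset β),
      (∀ a ∈ EA, ∀ b ∈ EB, B.Follows (z a b) l v (f a b)) →
      Rounds B.Node (2 * r) EA EB f := by
  classical
  induction hs with
  | nil =>
    intro v EA EB h
    rcases hk : B.kind v with p | c
    · refine ⟨true, fun a ha b hb => ?_⟩
      obtain ⟨w, rfl, h2⟩ := h a ha b hb
      rw [hk] at h2; cases h2
    · refine ⟨c, fun a ha b hb => ?_⟩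
      obtain ⟨w, rfl, h2⟩ := h a ha b hb
      rw [hk] at h2; simpa using h2.symm
  | @left r l₁ l₂ hav _ ih =>
    intro v EA EB h
    -- No query in `l₁` touches `X`, so the node reached depends on `b` alone.
    have hm : ∀ b, ∃ w, ∀ a ∈ EA, ∀ w', B.Reach (z a b) l₁ v w' → w' = w := by
      intro b
      by_cases hex : ∃ a ∈ EA, ∃ w, B.Reach (z a b) l₁ v w
      · obtain ⟨a, _, w, hw⟩ := hex
        exact ⟨w, fun a' _ w' hw' =>
          (hw'.congr (fun i hi => hX a' a b i (hav i hi))).unique hw⟩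
      · exact ⟨v, fun a ha w' hw' => (hex ⟨a, ha, w', hw'⟩).elim⟩
    choose m hm using hm
    -- Each block is given two messages so that the speaking order is always the same; here the
    -- second one is a dummy.
    refine ⟨m, fun q => ⟨fun _ => v, fun q' => ?_⟩⟩
    refine ih q _ _ fun a ha b hb => ?_
    simp only [Finset.mem_filter] at ha hb
    obtain ⟨w, h1, h2⟩ := h a ha.1 b hb.1
    obtain ⟨u, h3, h4⟩ := reach_append h1
    obtain rfl := hm b a ha.1 u h3
    exact ⟨w, hb.2 ▸ h4, h2⟩
  | @right r l₁ l₂ hav _ ih =>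
    intro v EA EB h
    have hm : ∀ a, ∃ w, ∀ b ∈ EB, ∀ w', B.Reach (z a b) l₁ v w' → w' = w := by
      intro a
      by_cases hex : ∃ b ∈ EB, ∃ w, B.Reach (z a b) l₁ v w
      · obtain ⟨b, _, w, hw⟩ := hex
        exact ⟨w, fun b' _ w' hw' =>
          (hw'.congr (fun i hi => hY a b' b i (hav i hi))).unique hw⟩
      · exact ⟨v, fun a ha w' hw' => (hex ⟨a, ha, w', hw'⟩).elim⟩
    choose m hm using hm
    refine ⟨fun _ => v, fun q => ⟨m, fun q' => ?_⟩⟩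
    refine ih q' _ _ fun a ha b hb => ?_
    simp only [Finset.mem_filter] at ha hb
    obtain ⟨w, h1, h2⟩ := h a ha.1 b hb.1
    obtain ⟨u, h3, h4⟩ := reach_append h1
    obtain rfl := hm a b hb.1 u h3
    exact ⟨w, ha.2 ▸ h4, h2⟩

end BranchingProgram

/-! ### Round elimination for pointer chasing. -/

/-- No protocol with `d` messages from an alphabet of `N` letters determines `f` on a rectangle
containing more than half of `A` and at least a quarter of `B`. -/
def RoundHard (N d : ℕ) {A B : Type} [Fintype A] [Fintype B] (f : A → B → Bool) : Prop :=
  ∀ (Q : Type) [Fintype Q], Fintype.card Q ≤ N → ∀ (EA : Finset A) (EB : Finset B),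
    Fintype.card A < 2 * EA.card → Fintype.card B ≤ 4 * EB.card → ¬ Rounds Q d EA EB f

/-- More than half of `Bool` is all of it, and the identity is not constant there. -/
theorem roundHard_zero (N : ℕ) : RoundHard N 0 (fun (a : Bool) (_ : Unit) => a) := by
  rintro Q _ - EA EB hA hB ⟨c, hc⟩
  have hA' : EA = Finset.univ := by
    refine Finset.eq_univ_of_card _ (le_antisymm (Finset.card_le_univ _) ?_)
    simp at hA ⊢; omega
  have hB' : () ∈ EB := by
    have : 0 < EB.card := by simp at hB; omega
    obtain ⟨u, hu⟩ := Finset.card_pos.1 this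
    exact hu
  have h1 := hc true (by simp [hA']) () hB'
  have h2 := hc false (by simp [hA']) () hB'
  simp [← h1] at h2

/-- A set with many small projections is small. -/
theorem card_mul_two_pow_le {b : ℕ} {A : Type} [Fintype A] [DecidableEq A]
    (E : Finset (Fin b → A)) (G : Finset (Fin b))
    (hG : ∀ j ∈ G, 2 * (E.image fun x => x j).card ≤ Fintype.card A) :
    E.card * 2 ^ G.card ≤ Fintype.card A ^ b := by
  have h1 : E.card ≤ ∏ j, (E.image fun x => x j).card := by
    rw [← Fintype.card_piFinset]
    refine Finset.card_le_card fun x hx => ?_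
    rw [Fintype.mem_piFinset]
    exact fun j => Finset.mem_image_of_mem _ hx
  have h2 : (2 : ℕ) ^ G.card = ∏ j : Fin b, if j ∈ G then 2 else 1 := by
    rw [Finset.prod_ite_mem]; simp
  calc E.card * 2 ^ G.card
      ≤ (∏ j, (E.image fun x => x j).card) * ∏ j : Fin b, if j ∈ G then 2 else 1 := by
        rw [h2]; gcongr
    _ = ∏ j : Fin b, (E.image fun x => x j).card * if j ∈ G then 2 else 1 :=
        Finset.prod_mul_distrib.symm
    _ ≤ ∏ _j : Fin b, Fintype.card A := by
        refine Finset.prod_le_prod' fun j _ => ?_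
        split_ifs with hj
        · linarith [hG j hj]
        · simpa using Finset.card_le_univ _
    _ = _ := by simp

/-- The pointer step: the first party picks which of `b` instances, with exchanged roles, is to be
evaluated. -/
theorem RoundHard.step {N d g b : ℕ} {A B : Type} [Fintype A] [Fintype B] [Nonempty A] [Nonempty B]
    {f : A → B → Bool} (hf : RoundHard N d f) (hg : 4 * N < 2 ^ g) (hb : b = 4 * g) :
    RoundHard N (d + 1) (fun (p : Fin b × (Fin b → B)) (x : Fin b → A) =>
      f (x p.1) (p.2 p.1)) := by
  classical
  rintro Q _ hQ EA EB hA hB ⟨m, hm⟩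
  have hB0 : 0 < Fintype.card B := Fintype.card_pos
  have hA0 : 0 < Fintype.card A := Fintype.card_pos
  simp only [Fintype.card_prod, Fintype.card_fin, Fintype.card_fun] at hA hB
  have hEB : 0 < EB.card := by
    have : 0 < Fintype.card A ^ b := by positivity
    omega
  -- the most popular message
  obtain ⟨q, hq⟩ : ∃ q, EB.card ≤ N * (EB.filter fun x => m x = q).card := by
    by_contra! hcon
    have h1 : EB.card = ∑ q, (EB.filter fun x => m x = q).card :=
      Finset.card_eq_sum_card_fiberwise (fun _ _ => Finset.mem_univ _)
    have hne : (Finset.univ : Finset Q).Nonempty := by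
      obtain ⟨x, _⟩ := Finset.card_pos.1 hEB
      exact ⟨m x, Finset.mem_univ _⟩
    have h2 : ∑ q, N * (EB.filter fun x => m x = q).card < ∑ _q : Q, EB.card :=
      Finset.sum_lt_sum_of_nonempty hne fun q _ => hcon q
    rw [← Finset.mul_sum, ← h1] at h2
    simp only [Finset.sum_const, Finset.card_univ, smul_eq_mul] at h2
    have := Nat.mul_le_mul_right EB.card hQ
    omega
  set E := EB.filter fun x => m x = q with hE
  -- few coordinates have small projection
  set G := Finset.univ.filter fun j : Fin b => 2 * (E.image fun x => x j).card ≤ Fintype.card A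
    with hGdef
  -- `E` has at least `|A|^b / (4N) > |A|^b / 2^g` elements, while each small projection costs a
  -- factor of two.
  have hGcard : G.card < g := by
    by_contra! hge
    have h1 := card_mul_two_pow_le E G (fun j hj => (Finset.mem_filter.1 hj).2)
    have h2 : 2 ^ g ≤ 2 ^ G.card := Nat.pow_le_pow_right (by norm_num) hge
    have hEpos : 0 < E.card := by
      rcases Nat.eq_zero_or_pos E.card with h | h
      · rw [h] at hq; omega
      · exact h
    have h3 : E.card * (4 * N) < E.card * 2 ^ G.card := by
      refine Nat.mul_lt_mul_of_pos_left ?_ hEpos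
      omega
    have h4 : E.card * (4 * N) = 4 * (N * E.card) := by ring
    omega
  -- many pointers are compatible with many continuations
  have hsum : EA.card = ∑ j : Fin b, (EA.filter fun p => p.1 = j).card :=
    Finset.card_eq_sum_card_fiberwise (fun _ _ => Finset.mem_univ _)
  obtain ⟨j, hjG, hj⟩ : ∃ j, j ∉ G ∧
      Fintype.card B ^ b ≤ 4 * (EA.filter fun p => p.1 = j).card := by
    by_contra! hcon
    have hle : ∀ j, (EA.filter fun p => p.1 = j).card ≤ Fintype.card B ^ b := by
      intro j
      have : (EA.filter fun p => p.1 = j).card ≤ (Finset.univ : Finset (Fin b → B)).card := by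
        refine Finset.card_le_card_of_injOn (fun p => p.2) (fun _ _ => Finset.mem_univ _) ?_
        intro p hp p' hp' h
        simp only [Finset.coe_filter, Set.mem_ofPred_eq] at hp hp'
        exact Prod.ext (hp.2.trans hp'.2.symm) h
      simpa using this
    -- Otherwise the fewer than `g` slices in `G` are at most full and the others less than a
    -- quarter full, so `4 |EA| ≤ (3g + 4g) |B|^b`. But `EA` is more than half of everything, so `4
    -- |EA| > 2b |B|^b = 8g |B|^b`.
    have h1 : 4 * EA.card ≤ ∑ j : Fin b, ((if j ∈ G then 3 * Fintype.card B ^ b else 0) +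
        Fintype.card B ^ b) := by
      rw [hsum, Finset.mul_sum]
      refine Finset.sum_le_sum fun j _ => ?_
      split_ifs with hjG
      · have := hle j; omega
      · have := hcon j hjG; omega
    rw [Finset.sum_add_distrib, Finset.sum_ite_mem] at h1
    simp only [Finset.univ_inter, Finset.sum_const, smul_eq_mul, Finset.card_univ,
      Fintype.card_fin] at h1
    have h2 : G.card * (3 * Fintype.card B ^ b) ≤ g * (3 * Fintype.card B ^ b) :=
      Nat.mul_le_mul_right _ hGcard.le
    have h3 : b * Fintype.card B ^ b = 4 * (g * Fintype.card B ^ b) := by rw [hb]; ring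
    have h4 : g * (3 * Fintype.card B ^ b) = 3 * (g * Fintype.card B ^ b) := by ring
    omega
  have hjG' : Fintype.card A < 2 * (E.image fun x => x j).card := by
    by_contra! h
    exact hjG (Finset.mem_filter.2 ⟨Finset.mem_univ _, h⟩)
  set F := (EA.filter fun p => p.1 = j).image fun p => p.2 j with hF
  -- Over each value of coordinate `j` lie at most `|B|^(b-1)` elements of the slice, so the
  -- projection keeps its density of a quarter.
  have hFcard : Fintype.card B ≤ 4 * F.card := by
    have h1 : (EA.filter fun p => p.1 = j).card ≤ F.card * Fintype.card B ^ (b - 1) := by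
      have h0 : (EA.filter fun p => p.1 = j).card ≤
          (F ×ˢ (Finset.univ : Finset ({i : Fin b // i ≠ j} → B))).card := by
        refine Finset.card_le_card_of_injOn (fun p => (p.2 j, fun i => p.2 i)) ?_ ?_
        · intro p hp
          simp only [Finset.coe_product, Set.mem_prod, Finset.mem_coe, Finset.mem_univ, and_true]
          exact Finset.mem_image_of_mem (fun p : Fin b × (Fin b → B) => p.2 j) hp
        · intro p hp p' hp' h
          simp only [Finset.coe_filter, Set.mem_ofPred_eq] at hp hp'
          simp only [Prod.mk.injEq] at h
          refine Prod.ext (hp.2.trans hp'.2.symm) (funext fun i => ?_)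
          by_cases hi : i = j
          · rw [hi]; exact h.1
          · exact congrFun h.2 ⟨i, hi⟩
      rw [Finset.card_product] at h0
      simpa [Fintype.card_subtype_compl] using h0
    have hb1 : b = (b - 1) + 1 := by have := j.pos; omega
    have hj' : Fintype.card B ^ (b - 1) * Fintype.card B ≤
        4 * (EA.filter fun p => p.1 = j).card := by
      rw [← pow_succ, ← hb1]; exact hj
    have hpos : 0 < Fintype.card B ^ (b - 1) := by positivity
    have h5 : Fintype.card B ^ (b - 1) * Fintype.card B ≤
        Fintype.card B ^ (b - 1) * (4 * F.card) := by
      calc _ ≤ 4 * (EA.filter fun p => p.1 = j).card := hj'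
        _ ≤ 4 * (F.card * Fintype.card B ^ (b - 1)) := by omega
        _ = _ := by ring
    exact Nat.le_of_mul_le_mul_left h5 hpos
  -- extend to full inputs
  have hφ : ∀ a : A, ∃ x : Fin b → A, a ∈ (E.image fun x => x j) → x ∈ E ∧ x j = a := by
    intro a
    by_cases ha : a ∈ E.image fun x => x j
    · obtain ⟨x, hx⟩ := Finset.mem_image.1 ha
      exact ⟨x, fun _ => hx⟩
    · exact ⟨fun _ => a, fun h => (ha h).elim⟩
  have hψ : ∀ y : B, ∃ p : Fin b × (Fin b → B), y ∈ F → p ∈ EA ∧ p.1 = j ∧ p.2 j = y := by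
    intro y
    by_cases hy : y ∈ F
    · obtain ⟨p, hp, hpy⟩ := Finset.mem_image.1 hy
      rw [Finset.mem_filter] at hp
      exact ⟨p, fun _ => ⟨hp.1, hp.2, hpy⟩⟩
    · exact ⟨(j, fun _ => y), fun h => (hy h).elim⟩
  choose φ hφ using hφ
  choose ψ hψ using hψ
  have hR : Rounds Q d (E.image fun x => x j) F
      (fun a y => f ((φ a) (ψ y).1) ((ψ y).2 (ψ y).1)) :=
    Rounds.comap (f := fun x p => f (x p.1) (p.2 p.1)) d φ ψ
      (fun a ha => (hφ a ha).1) (fun y hy => (hψ y hy).1) (by convert hm q)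
  refine hf Q hQ _ F hjG' hFcard (hR.congr fun a ha y hy => ?_)
  rw [(hψ y hy).2.1, (hψ y hy).2.2, (hφ a ha).2]

/-! ### Encoding pointer chasing into medians. -/

/-- Sets `SA a`, `SB b` of numbers below `W`, of fixed sizes `p`, `q`, such that the parity of
the median of `SA a ∪ SB b` is `f a b`. -/
structure MedianEncoding (W h p q : ℕ) {A B : Type} (f : A → B → Bool)
    (SA : A → Finset ℕ) (SB : B → Finset ℕ) : Prop where
  even : Even W
  card_add : p + q = 2 * h + 1
  le_width : 2 * h + 1 ≤ W
  card_left : ∀ a, (SA a).card = p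
  card_right : ∀ b, (SB b).card = q
  lt_left : ∀ a, ∀ v ∈ SA a, v < W
  lt_right : ∀ b, ∀ v ∈ SB b, v < W
  disjoint : ∀ a b, Disjoint (SA a) (SB b)
  median : ∀ a b, ∃ v, (v ∈ SA a ∨ v ∈ SB b) ∧ v.testBit 0 = f a b ∧
    ((SA a).filter (· < v)).card + ((SB b).filter (· < v)).card = h

theorem medianEncoding_base : MedianEncoding 2 0 1 0 (fun (a : Bool) (_ : Unit) => a)
    (fun a => {a.toNat}) (fun _ => ∅) where
  even := by decide
  card_add := rfl
  le_width := by decide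
  card_left := by simp
  card_right := by simp
  lt_left := by simp
  lt_right := by simp
  disjoint := by simp
  median := fun a b => ⟨a.toNat, by simp, by cases a <;> rfl, by
    simp [Finset.filter_singleton]⟩

/-- Translates of the sets `U i` into consecutive intervals of length `W`. -/
def stack (W : ℕ) {b : ℕ} (U : Fin b → Finset ℕ) : Finset ℕ :=
  Finset.univ.biUnion fun i : Fin b => (U i).image fun u => u + (b + i) * W

theorem mem_stack {W b : ℕ} {U : Fin b → Finset ℕ} {v : ℕ} :
    v ∈ stack W U ↔ ∃ i, ∃ u ∈ U i, u + (b + i) * W = v := by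
  simp [stack]

theorem stack_pairwise {W b : ℕ} {i j u v : ℕ} (hu : u < W) (hv : v < W)
    (h : u + (b + i) * W = v + (b + j) * W) : i = j ∧ u = v := by
  have hW : 0 < W := by omega
  have h1 : (u + (b + i) * W) / W = (v + (b + j) * W) / W := by rw [h]
  rw [Nat.add_mul_div_right _ _ hW, Nat.add_mul_div_right _ _ hW, Nat.div_eq_of_lt hu,
    Nat.div_eq_of_lt hv] at h1
  have h2 : i = j := by omega
  subst h2
  exact ⟨rfl, by omega⟩

theorem stack_bounds {W b : ℕ} {U : Fin b → Finset ℕ} (hU : ∀ i, ∀ u ∈ U i, u < W) {v : ℕ}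
    (hv : v ∈ stack W U) : b * W ≤ v ∧ v < 2 * b * W := by
  obtain ⟨i, u, hu, rfl⟩ := mem_stack.1 hv
  have h1 := hU i u hu
  have h2 : (i : ℕ) + 1 ≤ b := i.2
  have h3 := Nat.mul_le_mul_right W h2
  constructor <;> nlinarith

theorem stack_disjoint {W b : ℕ} {U V : Fin b → Finset ℕ} (hU : ∀ i, ∀ u ∈ U i, u < W)
    (hV : ∀ i, ∀ u ∈ V i, u < W) (h : ∀ i, Disjoint (U i) (V i)) :
    Disjoint (stack W U) (stack W V) := by
  rw [Finset.disjoint_left]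
  intro v hv hv'
  obtain ⟨i, u, hu, rfl⟩ := mem_stack.1 hv
  obtain ⟨j, w, hw, hjw⟩ := mem_stack.1 hv'
  obtain ⟨hij, rfl⟩ := stack_pairwise (hV j w hw) (hU i u hu) hjw
  obtain rfl := Fin.ext hij
  exact Finset.disjoint_left.1 (h j) hu hw

theorem card_filter_stack {W b : ℕ} {U : Fin b → Finset ℕ} (hU : ∀ i, ∀ u ∈ U i, u < W)
    (P : ℕ → Prop) [DecidablePred P] :
    ((stack W U).filter P).card =
      ∑ i : Fin b, ((U i).filter fun u => P (u + (b + i) * W)).card := by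
  rw [stack, Finset.filter_biUnion, Finset.card_biUnion]
  · refine Finset.sum_congr rfl fun i _ => ?_
    rw [Finset.filter_image, Finset.card_image_of_injective]
    exact fun x y h => Nat.add_right_cancel h
  · intro i _ j _ hij
    rw [Function.onFun, Finset.disjoint_left]
    intro v hv hv'
    simp only [Finset.mem_filter, Finset.mem_image] at hv hv'
    obtain ⟨⟨u, hu, rfl⟩, _⟩ := hv
    obtain ⟨⟨w, hw, h⟩, _⟩ := hv'
    exact hij (Fin.ext (stack_pairwise (hU i u hu) (hU j w hw) h.symm).1)

theorem card_stack {W b q : ℕ} {U : Fin b → Finset ℕ} (hU : ∀ i, ∀ u ∈ U i, u < W)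
    (hq : ∀ i, (U i).card = q) : (stack W U).card = b * q := by
  have := card_filter_stack hU (fun _ => True)
  simpa [hq] using this

theorem card_filter_lt_stack {W b q : ℕ} {U : Fin b → Finset ℕ} (hU : ∀ i, ∀ u ∈ U i, u < W)
    (hq : ∀ i, (U i).card = q) (j : Fin b) {v : ℕ} (hv : v < W) :
    ((stack W U).filter (· < v + (b + j) * W)).card =
      j * q + ((U j).filter (· < v)).card := by
  rw [card_filter_stack hU]
  have h1 : ∀ i : Fin b, ((U i).filter fun u => u + (b + i) * W < v + (b + j) * W).card =
      (if i < j then q else 0) + if i = j then ((U j).filter (· < v)).card else 0 := by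
    intro i
    rcases lt_trichotomy i j with hij | hij | hij
    · rw [if_pos hij, if_neg hij.ne, ← hq i, add_zero, Finset.filter_true_of_mem]
      intro u hu
      have h1 := hU i u hu
      have h2 : (i : ℕ) + 1 ≤ j := hij
      have h3 := Nat.mul_le_mul_right W h2
      nlinarith
    · subst hij
      simp
    · rw [if_neg hij.not_gt, if_neg hij.ne', add_zero, Finset.filter_false_of_mem]; · rfl
      intro u hu
      have h2 : (j : ℕ) + 1 ≤ i := hij
      have h3 := Nat.mul_le_mul_right W h2
      nlinarith
  rw [Finset.sum_congr rfl fun i _ => h1 i, Finset.sum_add_distrib, Finset.sum_ite_eq',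
    ← Finset.sum_filter]
  have h2 : Finset.univ.filter (· < j) = Finset.Iio j := by ext; simp
  simp [h2]

/-- The numbers by which the holder of the pointer `j` moves the median into the `j`-th
interval. -/
def shiftSet (W M : ℕ) {b : ℕ} (j : Fin b) : Finset ℕ :=
  Finset.range ((b - 1 - j) * M) ∪ (Finset.range (j * M)).image (· + 2 * b * W)

theorem mem_shiftSet {W M b : ℕ} {j : Fin b} {v : ℕ} : v ∈ shiftSet W M j ↔
    v < (b - 1 - j) * M ∨ (2 * b * W ≤ v ∧ v < 2 * b * W + j * M) := by
  simp only [shiftSet, Finset.mem_union, Finset.mem_range, Finset.mem_image]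
  refine or_congr Iff.rfl ⟨?_, ?_⟩
  · rintro ⟨u, hu, rfl⟩; constructor <;> omega
  · rintro ⟨h1, h2⟩; exact ⟨v - 2 * b * W, by omega, by omega⟩

theorem shift_low_le {W M b : ℕ} (hM : M ≤ W) (j : Fin b) : (b - 1 - j) * M ≤ b * W :=
  Nat.mul_le_mul (by omega) hM

theorem shift_high_le {W M b : ℕ} (hM : M ≤ W) (j : Fin b) : j * M ≤ b * W :=
  Nat.mul_le_mul j.2.le hM

/-- The cardinality does not depend on `j`: the pointer holder occupies the same number of positions
whatever the pointer is. -/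
theorem card_shiftSet {W M b : ℕ} (hM : M ≤ W) (j : Fin b) :
    (shiftSet W M j).card = (b - 1) * M := by
  rw [shiftSet, Finset.card_union_of_disjoint, Finset.card_image_of_injective,
    Finset.card_range, Finset.card_range, ← add_mul]
  · congr 1; have := j.2; omega
  · exact fun x y h => Nat.add_right_cancel h
  · rw [Finset.disjoint_left]
    intro v hv hv'
    have h1 := shift_low_le hM j
    simp only [Finset.mem_range, Finset.mem_image] at hv hv'
    obtain ⟨u, _, rfl⟩ := hv'
    have h2 : 2 * b * W = b * W + b * W := by ring
    omega

/-- The range has three zones of length `b * W`: low shifts, the stacked copies, high shifts. Each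
copy holds `M = 2 * h + 1` numbers. Below the median of copy `j` lie `(b - 1 - j) * M` low shifts,
`j * M` numbers of earlier copies and `h` of its own. The sum is independent of `j` and is half of
the remaining `(2 * b - 1) * M - 1` numbers. -/
theorem MedianEncoding.step {W h p q b : ℕ} {A B : Type} {f : A → B → Bool}
    {SA : A → Finset ℕ} {SB : B → Finset ℕ} (H : MedianEncoding W h p q f SA SB) (hb : 0 < b) :
    MedianEncoding (3 * b * W) ((b - 1) * (2 * h + 1) + h) ((b - 1) * (2 * h + 1) + b * q) (b * p)
      (fun (a : Fin b × (Fin b → B)) (x : Fin b → A) => f (x a.1) (a.2 a.1))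
      (fun a => shiftSet W (2 * h + 1) a.1 ∪ stack W fun i => SB (a.2 i))
      (fun x => stack W fun i => SA (x i)) := by
  have hM := H.le_width
  have e2 : 2 * b * W = b * W + b * W := by ring
  have e3 : 3 * b * W = b * W + b * W + b * W := by ring
  have hdis : ∀ (j : Fin b) (U : Fin b → Finset ℕ), (∀ i, ∀ u ∈ U i, u < W) →
      Disjoint (shiftSet W (2 * h + 1) j) (stack W U) := by
    intro j U hU
    rw [Finset.disjoint_left]
    intro v hv hv'
    have h1 := shift_low_le hM j
    have h2 := stack_bounds hU hv'
    rcases mem_shiftSet.1 hv with h | h <;> omega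
  refine ⟨H.even.mul_left _, ?_, ?_, ?_, ?_, ?_, ?_, ?_, ?_⟩
  · have h1 := H.card_add
    obtain ⟨c, rfl⟩ : ∃ c, b = c + 1 := ⟨b - 1, by omega⟩
    simp only [Nat.add_sub_cancel]
    have h2 : (c + 1) * q + (c + 1) * p = (c + 1) * (2 * h + 1) := by rw [← h1]; ring
    linarith
  · obtain ⟨c, rfl⟩ : ∃ c, b = c + 1 := ⟨b - 1, by omega⟩
    simp only [Nat.add_sub_cancel]
    nlinarith
  · intro a
    rw [Finset.card_union_of_disjoint (hdis _ _ fun i => H.lt_right _), card_shiftSet hM,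
      card_stack (fun i => H.lt_right _) (fun i => H.card_right _)]
  · intro x
    exact card_stack (fun i => H.lt_left _) (fun i => H.card_left _)
  · intro a v hv
    rcases Finset.mem_union.1 hv with hv | hv
    · have h1 := shift_low_le hM a.1
      have h2 := shift_high_le hM a.1
      have hW : 0 < b * W := Nat.mul_pos hb (by omega)
      rcases mem_shiftSet.1 hv with h | h <;> omega
    · have := stack_bounds (fun i => H.lt_right _) hv
      omega
  · intro x v hv
    have := stack_bounds (fun i => H.lt_left _) hv
    omega
  · intro a x
    rw [Finset.disjoint_union_left]
    exact ⟨hdis _ _ fun i => H.lt_left _, stack_disjoint (fun i => H.lt_right _)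
      (fun i => H.lt_left _) fun i => (H.disjoint _ _).symm⟩
  · rintro ⟨j, y⟩ x
    obtain ⟨v, hv, hbit, hcard⟩ := H.median (x j) (y j)
    have hvW : v < W := hv.elim (H.lt_left _ v) (H.lt_right _ v)
    refine ⟨v + (b + j) * W, ?_, ?_, ?_⟩
    · rcases hv with hv | hv
      · exact Or.inr (mem_stack.2 ⟨j, v, hv, rfl⟩)
      · exact Or.inl (Finset.mem_union_right _ (mem_stack.2 ⟨j, v, hv, rfl⟩))
    -- Evenness of `W` is what makes the translation preserve the parity.
    · rw [← hbit]
      obtain ⟨w, hw⟩ := H.even.mul_left (b + j : ℕ)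
      simp only [Nat.testBit_zero, hw]
      congr 1
      rw [eq_iff_iff]
      omega
    · have hlow : ((shiftSet W (2 * h + 1) j).filter (· < v + (b + j) * W)) =
          Finset.range ((b - 1 - j) * (2 * h + 1)) := by
        ext u
        have h1 := shift_low_le hM j
        have h2 : b * W ≤ (b + j) * W := Nat.mul_le_mul_right _ (by omega)
        have h3 : (b + j) * W + W ≤ 2 * b * W := by
          have h2 : (j : ℕ) + 1 ≤ b := j.2
          have h3 := Nat.mul_le_mul_right W h2
          nlinarith
        rw [Finset.mem_filter, mem_shiftSet, Finset.mem_range]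
        omega
      dsimp only
      rw [Finset.filter_union, Finset.card_union_of_disjoint
        (Finset.disjoint_filter_filter (hdis _ _ fun i => H.lt_right _)), hlow, Finset.card_range,
        card_filter_lt_stack (fun i => H.lt_right _) (fun i => H.card_right _) j hvW,
        card_filter_lt_stack (fun i => H.lt_left _) (fun i => H.card_left _) j hvW]
      have h1 : (b - 1 - j) * (2 * h + 1) + j * (2 * h + 1) = (b - 1) * (2 * h + 1) := by
        rw [← add_mul]; congr 1; have := j.2; omega
      have h2 : (j : ℕ) * (2 * h + 1) = j * p + j * q := by rw [← H.card_add]; ring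
      omega

/-- A function that is hard for `d` messages and has a median encoding of width
`2 * (3 * b) ^ d`. -/
theorem exists_hard_medianEncoding {N g b : ℕ} (hg : 4 * N < 2 ^ g) (hb : b = 4 * g) (hb0 : 0 < b)
    (d : ℕ) : ∃ (h p q : ℕ) (A B : Type) (_ : Fintype A) (_ : Fintype B) (f : A → B → Bool)
      (SA : A → Finset ℕ) (SB : B → Finset ℕ), Nonempty A ∧ Nonempty B ∧ RoundHard N d f ∧
        MedianEncoding (2 * (3 * b) ^ d) h p q f SA SB := by
  induction d with
  | zero =>
    exact ⟨0, 1, 0, Bool, Unit, inferInstance, inferInstance, _, _, _, inferInstance,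
      inferInstance, roundHard_zero N, by simpa using medianEncoding_base⟩
  | succ d ih =>
    classical
    obtain ⟨h, p, q, A, B, _, _, f, SA, SB, _, _, hf, H⟩ := ih
    have : Nonempty (Fin b) := ⟨⟨0, hb0⟩⟩
    have hH := H.step hb0
    rw [show 3 * b * (2 * (3 * b) ^ d) = 2 * (3 * b) ^ (d + 1) by ring] at hH
    exact ⟨_, _, _, _, _, _, _, _, _, _, inferInstance, inferInstance, hf.step hg hb, hH⟩

/-! ### Realising encodings as inputs of the program. -/

theorem orderStatistic_eq {n m r v : ℕ} {x : Fin n → UpTo m} (hv : ∃ i, (x i : ℕ) = v)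
    (hr : (Finset.univ.filter fun i => (x i : ℕ) < v).card + 1 = r) :
    orderStatistic r x = v := by
  obtain ⟨i, hi⟩ := hv
  refine IsLeast.csInf_eq ⟨?_, fun w hw => ?_⟩
  · change r ≤ _
    rw [← hr]
    refine Finset.card_lt_card ?_
    rw [Finset.ssubset_iff_of_subset]
    · exact ⟨i, by simp [hi], by simp [hi]⟩
    · intro j hj
      simp only [Finset.mem_filter] at hj ⊢
      exact ⟨hj.1, hj.2.le⟩
  · by_contra! hlt
    have hw : r ≤ (Finset.univ.filter fun i => (x i : ℕ) ≤ w).card := hw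
    have : (Finset.univ.filter fun i => (x i : ℕ) ≤ w).card ≤
        (Finset.univ.filter fun i => (x i : ℕ) < v).card := by
      refine Finset.card_le_card fun j hj => ?_
      simp only [Finset.mem_filter] at hj ⊢
      exact ⟨hj.1, by omega⟩
    omega

theorem exists_enumeration {α : Type*} [DecidableEq α] (P : Finset α) (S : Finset ℕ)
    (h : P.card = S.card) : ∃ g : α → ℕ, Set.InjOn g P ∧ P.image g = S := by
  let e := Finset.equivOfCardEq h
  refine ⟨fun i => if hi : i ∈ P then e ⟨i, hi⟩ else 0, ?_, ?_⟩
  · intro i hi j hj hij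
    have hi' : i ∈ P := hi
    have hj' : j ∈ P := hj
    simp only [hi', hj', dif_pos] at hij
    simpa using e.injective (Subtype.ext hij)
  · ext v
    simp only [Finset.mem_image]
    constructor
    · rintro ⟨i, hi, rfl⟩
      simp [hi]
    · intro hv
      refine ⟨e.symm ⟨v, hv⟩, (e.symm ⟨v, hv⟩).2, ?_⟩
      simp

theorem card_filter_enumeration {α : Type*} [DecidableEq α] {P : Finset α} {S : Finset ℕ}
    {g : α → ℕ} (hg : Set.InjOn g P) (hS : P.image g = S) (p : ℕ → Prop) [DecidablePred p] :
    (P.filter fun i => p (g i)).card = (S.filter p).card := by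
  rw [← hS, Finset.filter_image, Finset.card_image_of_injOn]
  exact hg.mono fun x hx => (Finset.mem_filter.1 hx).1

/-- Realisation of a median encoding by inputs, the two parties holding disjoint sets of
positions. -/
theorem MedianEncoding.exists_inputs {W h p q n r : ℕ} {A B : Type} {f : A → B → Bool}
    {SA : A → Finset ℕ} {SB : B → Finset ℕ} (H : MedianEncoding W h p q f SA SB)
    (hn : 4 * W ≤ n) (hr : IsMedianRank n r) {X Y : Finset (Fin n)} (hXY : Disjoint X Y)
    (hX : X.card = p) (hY : Y.card = q) :
    ∃ z : A → B → Fin n → UpTo (2 * n), (∀ a a' b i, i ∉ X → z a b i = z a' b i) ∧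
      (∀ a b b' i, i ∉ Y → z a b i = z a b' i) ∧
      ∀ a b, Function.Injective (z a b) ∧ medianBit r (z a b) = f a b := by
  have hM := H.le_width
  have hpq := H.card_add
  have hr1 : h + 1 ≤ r := by rcases hr with hr | hr <;> omega
  have hr2 : r + h ≤ n := by rcases hr with hr | hr <;> omega
  obtain ⟨l, hl⟩ : ∃ l, r = h + 1 + l := ⟨r - (h + 1), by omega⟩
  obtain ⟨u, hu⟩ : ∃ u, n = r + h + u := ⟨n - (r + h), by omega⟩
  -- The encoding is translated by `o`, even to preserve parity and larger than `l` to leave room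
  -- for the `l` small padding values. With `u` large ones above, the encoded median gets rank `r =
  -- h + 1 + l`.
  obtain ⟨o, ho, ho1, ho2⟩ : ∃ o, Even o ∧ l + 1 ≤ o ∧ o ≤ l + 2 := by
    rcases Nat.even_or_odd l with he | he
    · exact ⟨l + 2, he.add even_two, by omega, le_rfl⟩
    · exact ⟨l + 1, he.add_one, le_rfl, by omega⟩
  set F := Finset.Icc 1 l ∪ Finset.Ico (o + W) (o + W + u) with hF
  set Z := (X ∪ Y)ᶜ with hZ
  have hXYc : (X ∪ Y).card = p + q := by rw [Finset.card_union_of_disjoint hXY, hX, hY]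
  have hFdisj : Disjoint (Finset.Icc 1 l) (Finset.Ico (o + W) (o + W + u)) := by
    rw [Finset.disjoint_left]
    intro v hv hv'
    rw [Finset.mem_Icc] at hv
    rw [Finset.mem_Ico] at hv'
    omega
  have hFcard : F.card = l + u := by
    rw [hF, Finset.card_union_of_disjoint hFdisj]; simp
  have hZcard : Z.card = F.card := by
    rw [hZ, Finset.card_compl, hXYc, hFcard, Fintype.card_fin]; omega
  have inj : Function.Injective (· + o : ℕ → ℕ) := fun x y h => Nat.add_right_cancel h
  have hSA : ∀ a, ∃ g : Fin n → ℕ, Set.InjOn g X ∧ X.image g = (SA a).image (· + o) :=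
    fun a => exists_enumeration _ _ (by rw [Finset.card_image_of_injective _ inj, H.card_left, hX])
  have hSB : ∀ b, ∃ g : Fin n → ℕ, Set.InjOn g Y ∧ Y.image g = (SB b).image (· + o) :=
    fun b => exists_enumeration _ _ (by rw [Finset.card_image_of_injective _ inj, H.card_right, hY])
  choose gA hgA hgA' using hSA
  choose gB hgB hgB' using hSB
  obtain ⟨gF, hgF, hgF'⟩ := exists_enumeration Z F hZcard
  set y : A → B → Fin n → ℕ := fun a b i =>
    if i ∈ X then gA a i else if i ∈ Y then gB b i else gF i with hy
  have yX : ∀ a b, ∀ i ∈ X, y a b i = gA a i := fun a b i hi => if_pos hi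
  have yY : ∀ a b, ∀ i ∈ Y, y a b i = gB b i := fun a b i hi => by
    simp [hy, hi, Finset.disjoint_right.1 hXY hi]
  have yZ : ∀ a b, ∀ i ∈ Z, y a b i = gF i := fun a b i hi => by
    simp only [hZ, Finset.mem_compl, Finset.mem_union, not_or] at hi
    simp [hy, hi]
  have hcover : Finset.univ = (X ∪ Y) ∪ Z := by rw [hZ, Finset.union_compl]
  have himage : ∀ a b, Finset.univ.image (y a b) =
      ((SA a).image (· + o) ∪ (SB b).image (· + o)) ∪ F := by
    intro a b
    rw [hcover, Finset.image_union, Finset.image_union, Finset.image_congr (yX a b),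
      Finset.image_congr (yY a b), Finset.image_congr (yZ a b), hgA', hgB', hgF']
  have hFout : ∀ v < W, v + o ∉ F := by
    intro v hv hv'
    rw [hF, Finset.mem_union, Finset.mem_Icc, Finset.mem_Ico] at hv'
    omega
  have hrange : ∀ a b i, 1 ≤ y a b i ∧ y a b i ≤ 2 * n := by
    intro a b i
    have hmem : y a b i ∈ Finset.univ.image (y a b) :=
      Finset.mem_image_of_mem _ (Finset.mem_univ i)
    rw [himage, Finset.mem_union, Finset.mem_union, Finset.mem_image, Finset.mem_image, hF,
      Finset.mem_union, Finset.mem_Icc, Finset.mem_Ico] at hmem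
    rcases hmem with (⟨v, hv, hvi⟩ | ⟨v, hv, hvi⟩) | hv
    · have := H.lt_left a v hv; omega
    · have := H.lt_right b v hv; omega
    · omega
  have hinj : ∀ a b, Function.Injective (y a b) := by
    intro a b
    rw [← Set.injOn_univ, ← Finset.coe_univ, ← Finset.card_image_iff, himage,
      Finset.card_union_of_disjoint, Finset.card_union_of_disjoint,
      Finset.card_image_of_injective _ inj, Finset.card_image_of_injective _ inj, H.card_left,
      H.card_right, hFcard, Finset.card_univ, Fintype.card_fin]
    · omega
    · exact (Finset.disjoint_image inj).2 (H.disjoint a b)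
    · rw [Finset.disjoint_left]
      intro v hv
      rw [Finset.mem_union, Finset.mem_image, Finset.mem_image] at hv
      rcases hv with ⟨w, hw, rfl⟩ | ⟨w, hw, rfl⟩
      · exact hFout w (H.lt_left a w hw)
      · exact hFout w (H.lt_right b w hw)
  refine ⟨fun a b i => ⟨y a b i, hrange a b i⟩, ?_, ?_, fun a b => ⟨?_, ?_⟩⟩
  · intro a a' b i hi
    simp [hy, hi]
  · intro a b b' i hi
    simp [hy, hi]
  · intro i j hij
    exact hinj a b (congrArg Subtype.val hij)
  · obtain ⟨v, hv, hbit, hcard⟩ := H.median a b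
    have hvW : v < W := hv.elim (H.lt_left _ v) (H.lt_right _ v)
    rw [medianBit, orderStatistic_eq (v := v + o), ← hbit]
    · obtain ⟨w, rfl⟩ := ho
      simp only [Nat.testBit_zero]
      congr 1
      rw [eq_iff_iff]
      omega
    · have : v + o ∈ Finset.univ.image (y a b) := by
        rw [himage]
        simp only [Finset.mem_union, Finset.mem_image, Nat.add_right_cancel_iff, exists_eq_right]
        exact Or.inl hv
      simpa using this
    · have hsplit : (Finset.univ.filter fun i => y a b i < v + o).card =
          (X.filter fun i => gA a i < v + o).card + (Y.filter fun i => gB b i < v + o).card +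
            (Z.filter fun i => gF i < v + o).card := by
        have e1 : X.filter (fun i => y a b i < v + o) = X.filter (fun i => gA a i < v + o) :=
          Finset.filter_congr fun i hi => by rw [yX a b i hi]
        have e2 : Y.filter (fun i => y a b i < v + o) = Y.filter (fun i => gB b i < v + o) :=
          Finset.filter_congr fun i hi => by rw [yY a b i hi]
        have e3 : Z.filter (fun i => y a b i < v + o) = Z.filter (fun i => gF i < v + o) :=
          Finset.filter_congr fun i hi => by rw [yZ a b i hi]
        rw [hcover, Finset.filter_union, Finset.card_union_of_disjoint
          (Finset.disjoint_filter_filter disjoint_compl_right), Finset.filter_union,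
          Finset.card_union_of_disjoint (Finset.disjoint_filter_filter hXY), e1, e2, e3]
      have hshift : ∀ S : Finset ℕ, ((S.image (· + o)).filter (· < v + o)).card =
          (S.filter (· < v)).card := by
        intro S
        rw [Finset.filter_image, Finset.card_image_of_injective _ inj]
        simp
      have hlow : F.filter (· < v + o) = Finset.Icc 1 l := by
        ext w
        rw [hF, Finset.mem_filter, Finset.mem_union, Finset.mem_Icc, Finset.mem_Ico]
        omega
      rw [hsplit, card_filter_enumeration (hgA a) (hgA' a) (· < v + o),
        card_filter_enumeration (hgB b) (hgB' b) (· < v + o),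
        card_filter_enumeration hgF hgF' (· < v + o), hshift, hshift, hlow, hcard]
      simp
      omega

/-! ### The lower bound on the size. -/

namespace BranchingProgram

variable {n : ℕ} {D R : Type}

/-- On each input with a defined output, an oblivious program queries the same list. -/
theorem Oblivious.exists_follows {B : BranchingProgram n D R} (h : B.Oblivious) :
    ∃ s : List (Fin n), (∀ x r, B.Outputs x r → B.Follows x s B.source r) := by
  obtain ⟨s, hs⟩ := h
  refine ⟨s, fun x r hx => ?_⟩
  obtain ⟨l, w, h1, h2⟩ := OutputsFrom.exists_follows hx
  obtain rfl := hs l w ⟨r, h2⟩ h1.path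
  exact ⟨w, h1, h2⟩

theorem medianBit_shift {n r c : ℕ} (hr : IsMedianRank n r) (hn : 2 ≤ n) (hc : c ≤ n) :
    medianBit r (fun i : Fin n => (⟨i + 1 + c, by omega, by omega⟩ : UpTo (2 * n))) =
      (r + c).testBit 0 := by
  have hr1 : 1 ≤ r := by rcases hr with hr | hr <;> omega
  have hr2 : r ≤ n := by rcases hr with hr | hr <;> omega
  rw [medianBit, orderStatistic_eq (v := r + c)]
  · exact ⟨⟨r - 1, by omega⟩, by simp; omega⟩
  · have : (Finset.univ.filter fun i : Fin n => (i : ℕ) + 1 + c < r + c) =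
        Finset.Iio (⟨r - 1, by omega⟩ : Fin n) := by
      ext i
      simp only [Finset.mem_filter, Finset.mem_univ, true_and, Finset.mem_Iio, Fin.lt_def]
      omega
    simp only [this, Fin.card_Iio]
    omega

/-- A one-node program is constant, but translating the input `1, …, n` by one flips the bit. The
bound excludes spaces below `1`, for which the real estimates would fail. -/
theorem two_le_size {n r : ℕ} (hr : IsMedianRank n r) (hn : 2 ≤ n)
    (B : BranchingProgram n (UpTo (2 * n)) Bool)
    (hB : ∀ x : Fin n → UpTo (2 * n), Function.Injective x → B.Outputs x (medianBit r x)) :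
    2 ≤ B.size := by
  by_contra! hlt
  have hsub : Subsingleton B.Node := Fintype.card_le_one_iff_subsingleton.1 (by
    unfold size at hlt; omega)
  rcases hk : B.kind B.source with ⟨i, next⟩ | c
  · exact B.acyclic B.source (Relation.TransGen.single
      ⟨i, next, ⟨1, le_rfl, by omega⟩, hk, Subsingleton.elim _ _⟩)
  · have hconst : ∀ x r, B.Outputs x r → r = c := by
      intro x r hx
      obtain ⟨l, w, _, hw⟩ := OutputsFrom.exists_follows hx
      rw [Subsingleton.elim w B.source, hk] at hw
      simpa using hw.symm
    have hout : ∀ e ≤ 1, (r + e).testBit 0 = c := by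
      intro e he
      rw [← medianBit_shift hr hn (by omega : e ≤ n)]
      refine hconst _ _ (hB _ fun i j hij => Fin.ext ?_)
      have := congrArg Subtype.val hij
      simp only at this
      omega
    have h0 := hout 0 (by omega)
    rw [← hout 1 le_rfl] at h0
    simp only [Nat.testBit_zero, decide_eq_decide] at h0
    omega

/-- At least half of the inputs are queried at most `K` times if `2 * T < (K + 1) * n`. -/
theorem card_filter_count_le {n T K : ℕ} {s : List (Fin n)} (hs : s.length ≤ T)
    (hK : 2 * T < (K + 1) * n) :
    n < 2 * (Finset.univ.filter fun i => s.count i ≤ K).card := by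
  have h1 : ∑ i, s.count i = s.length := by
    simpa using Multiset.sum_count_eq_card (s := Finset.univ) (m := (s : Multiset (Fin n)))
      (fun _ _ => Finset.mem_univ _)
  have h2 : (Finset.univ.filter fun i => ¬ s.count i ≤ K).card * (K + 1) ≤ s.length := by
    rw [← h1, ← smul_eq_mul]
    refine (Finset.card_nsmul_le_sum _ (fun i => s.count i) _ fun i hi => ?_).trans
      (Finset.sum_le_univ_sum_of_nonneg fun _ => Nat.zero_le _)
    have := (Finset.mem_filter.1 hi).2
    omega
  have h3 := Finset.card_filter_add_card_filter_not (s := Finset.univ) fun i => s.count i ≤ K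
  rw [Finset.card_univ, Fintype.card_fin] at h3
  by_contra! hcon
  have h4 : n ≤ 2 * (Finset.univ.filter fun i => ¬ s.count i ≤ K).card := by omega
  have h5 := Nat.mul_le_mul_right (K + 1) h4
  nlinarith

theorem size_lower_bound {n r : ℕ} (hr : IsMedianRank n r)
    (B : BranchingProgram n (UpTo (2 * n)) Bool) (hobl : B.Oblivious)
    (hB : ∀ x : Fin n → UpTo (2 * n), Function.Injective x → B.Outputs x (medianBit r x))
    {T K g : ℕ} (hT : B.RunsInTime T) (hK : 2 * T < (K + 1) * n)
    (hn : 8 * 4 ^ K * (12 * g) ^ (4 * K + 2) ≤ n) (hg0 : 0 < g) : 2 ^ g ≤ 4 * B.size := by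
  classical
  by_contra! hg
  obtain ⟨h, p, q, α, β, _, _, f, SA, SB, _, _, hf, H⟩ :=
    exists_hard_medianEncoding hg (rfl : 4 * g = 4 * g) (by omega) (4 * K + 2)
  set W := 2 * (3 * (4 * g)) ^ (4 * K + 2) with hW
  have hWn : 4 * 4 ^ K * W ≤ n := by
    rw [hW, ← mul_assoc 3 4 g]
    calc _ = 8 * 4 ^ K * (12 * g) ^ (4 * K + 2) := by ring
      _ ≤ n := hn
  have h4K : 1 ≤ 4 ^ K := Nat.one_le_pow _ _ (by norm_num)
  have hW4 : 4 * W ≤ n := le_trans (Nat.mul_le_mul_right _ (by omega)) hWn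
  obtain ⟨s, hs⟩ := hobl.exists_follows
  have hM := H.le_width
  have hpq := H.card_add
  -- Obliviousness alone does not bound `s`; one actual run is needed to realise it as a path to a
  -- sink.
  have hslen : s.length ≤ T := by
    obtain ⟨w, h1, h2⟩ := hs _ _ (hB (fun i : Fin n => ⟨i + 1, by omega, by omega⟩)
      fun i j hij => Fin.ext (by simpa using hij))
    exact hT s w ⟨_, h2⟩ h1.path
  have hgood := card_filter_count_le hslen hK
  set G := Finset.univ.filter fun i => s.count i ≤ K with hG
  obtain ⟨X, hXG, hX⟩ := Finset.exists_subset_card_eq (show G.card / 2 ≤ G.card by omega)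
  have hsd : (G \ X).card = G.card - G.card / 2 := by
    rw [Finset.card_sdiff_of_subset hXG, hX]
  -- Two indices of `G` occur at most `2 * K` times together, so there are `2 * K + 1` blocks and
  -- the sets shrink by a factor of at most `4 ^ K`.
  obtain ⟨X', hX', Y', hY', hXc, hYc, hsplit⟩ := exists_splitsInto (2 * K) s X (G \ X)
    Finset.disjoint_sdiff fun x hx y hy => by
      have h1 := (Finset.mem_filter.1 (hXG hx)).2
      have h2 := (Finset.mem_filter.1 (Finset.mem_sdiff.1 hy).1).2
      omega
  rw [pow_mul, show (2 : ℕ) ^ 2 = 4 by norm_num] at hXc hYc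
  have hbig : ∀ c, G.card / 2 ≤ 4 ^ K * c → W ≤ c := by
    intro c hc
    by_contra! hlt
    have h1 : 4 ^ K * (c + 1) ≤ 4 ^ K * W := Nat.mul_le_mul_left _ hlt
    have h2 : 4 * 4 ^ K * W = 4 * (4 ^ K * W) := by ring
    rw [mul_add, mul_one] at h1
    omega
  obtain ⟨X₁, hX₁, hX₁c⟩ := Finset.exists_subset_card_eq
    (show p ≤ X'.card from le_trans (by omega) (hbig _ (by omega)))
  obtain ⟨Y₁, hY₁, hY₁c⟩ := Finset.exists_subset_card_eq
    (show q ≤ Y'.card from le_trans (by omega) (hbig _ (by omega)))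
  have hdisj : Disjoint X₁ Y₁ :=
    Finset.disjoint_of_subset_left (hX₁.trans hX')
      (Finset.disjoint_of_subset_right (hY₁.trans hY') Finset.disjoint_sdiff)
  obtain ⟨z, hz1, hz2, hz3⟩ := H.exists_inputs hW4 hr hdisj hX₁c hY₁c
  have hR := rounds_of_splitsInto (hsplit.subset hX₁ hY₁) z hz1 hz2 f B.source
    Finset.univ Finset.univ fun a _ b _ => by
      rw [← (hz3 a b).2]
      exact hs _ _ (hB _ (hz3 a b).1)
  rw [show 2 * (2 * K + 1) = 4 * K + 2 by ring] at hR
  refine hf B.Node le_rfl _ _ ?_ ?_ hR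
  · have : 0 < Fintype.card α := Fintype.card_pos
    rw [Finset.card_univ]; omega
  · rw [Finset.card_univ]; omega

end BranchingProgram

/-! ### Passage to real exponents and the time bound. -/

namespace BranchingProgram

/-- The real form of the size bound, with constant `1 / 240`. -/
theorem rpow_le_space {n r : ℕ} (hn : 2 ≤ n) (hr : IsMedianRank n r)
    (B : BranchingProgram n (UpTo (2 * n)) Bool) (hobl : B.Oblivious)
    (hB : ∀ x : Fin n → UpTo (2 * n), Function.Injective x → B.Outputs x (medianBit r x))
    {T : ℕ} (hT : B.RunsInTime T) {k : ℝ} (hk : (T : ℝ) ≤ k * n) :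
    1 / 240 * (n : ℝ) ^ ((1 : ℝ) / (2 : ℝ) ^ (4 * k + 2)) ≤ B.space := by
  by_contra! hlt
  have hsize : (2 : ℝ) ≤ B.size := by exact_mod_cast two_le_size hr hn B hB
  have hS1 : 1 ≤ B.space := by
    rw [space, Real.le_logb_iff_rpow_le (by norm_num) (by linarith)]
    simpa using hsize
  have hn0 : (0 : ℝ) < n := by positivity
  have hn1 : (1 : ℝ) ≤ n := by exact_mod_cast (by omega : 1 ≤ n)
  have hk0 : 0 ≤ k := by
    by_contra! h
    have : k * n < 0 := mul_neg_of_neg_of_pos h hn0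
    have : (0 : ℝ) ≤ T := Nat.cast_nonneg T
    linarith
  set K := ⌊2 * k⌋₊ with hKdef
  have hK1 : (K : ℝ) ≤ 2 * k := Nat.floor_le (by positivity)
  have hK2 : 2 * k < K + 1 := Nat.lt_floor_add_one _
  have hKT : 2 * T < (K + 1) * n := by
    have : (2 * T : ℝ) < (K + 1) * n := by nlinarith
    exact_mod_cast this
  set d := 4 * K + 2 with hd
  have hd2 : (2 * d : ℝ) ≤ (2 : ℝ) ^ (4 * k + 2) := by
    have h1 : ∀ K : ℕ, 2 * (4 * K + 2) ≤ 2 ^ (2 * K + 2) := by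
      intro K
      induction K with
      | zero => norm_num
      | succ K ih =>
        have e : 2 ^ (2 * (K + 1) + 2) = 4 * 2 ^ (2 * K + 2) := by ring
        omega
    have h2 : (2 * d : ℝ) ≤ (2 : ℝ) ^ (2 * K + 2) := by exact_mod_cast h1 K
    refine h2.trans ?_
    rw [← Real.rpow_natCast]
    refine Real.rpow_le_rpow_of_exponent_le (by norm_num) ?_
    push_cast
    linarith
  have hd0 : (0 : ℝ) < d := by rw [hd]; positivity
  set y := (n : ℝ) ^ ((1 : ℝ) / (2 * d)) with hy
  have hyn : (n : ℝ) ^ ((1 : ℝ) / (2 : ℝ) ^ (4 * k + 2)) ≤ y := by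
    refine Real.rpow_le_rpow_of_exponent_le hn1 ?_
    exact one_div_le_one_div_of_le (by positivity) hd2
  have hyd : y ^ d ≤ n := by
    rw [hy, ← Real.rpow_natCast, ← Real.rpow_mul hn0.le]
    conv_rhs => rw [← Real.rpow_one (n : ℝ)]
    refine Real.rpow_le_rpow_of_exponent_le hn1 ?_
    rw [div_mul_eq_mul_div, div_le_one (by positivity)]
    linarith
  -- The `3` makes `2 ^ g ≥ 8 * size`, contradicting `size_lower_bound`. As the space is at least
  -- `1`, `g` is at most five times the space; with the base `48 * g` below this gives the constant
  -- `240`.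
  set g := ⌈B.space⌉₊ + 3 with hg
  have hg1 : B.space ≤ ⌈B.space⌉₊ := Nat.le_ceil _
  have hg2 : (⌈B.space⌉₊ : ℝ) < B.space + 1 := Nat.ceil_lt_add_one (by linarith)
  have hgy : (48 * g : ℝ) ≤ y := by
    rw [hg]; push_cast; linarith
  have hbound : 8 * 4 ^ K * (12 * g) ^ (4 * K + 2) ≤ n := by
    -- The loss from shrinking the sets is absorbed by enlarging the base from `12 * g` to `48 * g`.
    have h1 : 8 * 4 ^ K ≤ 4 ^ (4 * K + 2) := by
      calc 8 * 4 ^ K ≤ 16 * 4 ^ (4 * K) :=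
            Nat.mul_le_mul (by norm_num) (Nat.pow_le_pow_right (by norm_num) (by omega))
        _ = _ := by ring
    have h2 : 8 * 4 ^ K * (12 * g) ^ (4 * K + 2) ≤ (48 * g) ^ d := by
      calc _ ≤ 4 ^ (4 * K + 2) * (12 * g) ^ (4 * K + 2) := Nat.mul_le_mul_right _ h1
        _ = (48 * g) ^ d := by rw [← mul_pow, hd]; congr 1; ring
    have h3 : ((48 * g : ℕ) : ℝ) ^ d ≤ n := by
      refine le_trans (pow_le_pow_left₀ (by positivity) ?_ d) hyd
      push_cast
      exact hgy
    exact h2.trans (by exact_mod_cast h3)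
  have hfin := size_lower_bound hr B hobl hB hT hKT hbound (by omega)
  have hsz : (B.size : ℝ) ≤ 2 ^ ⌈B.space⌉₊ := by
    rw [← Real.rpow_natCast, ← Real.logb_le_iff_le_rpow (by norm_num) (by linarith)]
    exact hg1
  have hfin' : (2 : ℝ) ^ g ≤ 4 * B.size := by exact_mod_cast hfin
  rw [hg, pow_add] at hfin'
  linarith

/-- The time bound implied by a lower bound on the space. -/
theorem time_bound {n T : ℕ} (hn : 2 ≤ n) {S c δ : ℝ} (hc : 0 < c) (hc1 : c ≤ 1) (hδ : 0 < δ)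
    (hS : S = 1 ∨ δ ≤ Real.log S) (hS0 : 0 < S)
    (h : c * (n : ℝ) ^ ((1 : ℝ) / (2 : ℝ) ^ (4 * ((T : ℝ) / n) + 2)) ≤ S) :
    0.25 * n * Real.logb 2 (Real.logb S n)
      - (0.5 + 0.25 * Real.logb 2 (1 - Real.log c / δ)) * n ≤ (T : ℝ) := by
  have hn0 : (0 : ℝ) < n := by positivity
  have hn1 : (1 : ℝ) < n := by exact_mod_cast (by omega : 1 < n)
  have hlc : Real.log c ≤ 0 := Real.log_nonpos hc.le hc1
  have hD1 : 1 ≤ 1 - Real.log c / δ := by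
    have := div_nonpos_of_nonpos_of_nonneg hlc hδ.le
    linarith
  set D := 1 - Real.log c / δ with hD
  have hlD : 0 ≤ Real.logb 2 D := Real.logb_nonneg (by norm_num) hD1
  -- For `S = 1` the base-`S` logarithm is `0` by convention, as is `logb 2 0`, and the claim
  -- reduces to `T ≥ 0`.
  rcases hS with rfl | hS
  · have : (0 : ℝ) ≤ T := Nat.cast_nonneg T
    have h2 : 0 ≤ (0.5 + 0.25 * Real.logb 2 D) * n := by positivity
    simp
    linarith
  · set e := (2 : ℝ) ^ (4 * ((T : ℝ) / n) + 2) with he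
    have he0 : 0 < e := by positivity
    have hlS : 0 < Real.log S := hδ.trans_le hS
    have h1 : Real.log c + 1 / e * Real.log n ≤ Real.log S := by
      have h2 := Real.log_le_log (by positivity) h
      rwa [Real.log_mul hc.ne' (by positivity), Real.log_rpow hn0] at h2
    have h2 : Real.log n ≤ e * (Real.log S - Real.log c) := by
      have h3 : 1 / e * Real.log n ≤ Real.log S - Real.log c := by linarith
      rw [one_div_mul_eq_div, div_le_iff₀ he0] at h3
      linarith
    -- With `log S ≥ δ`, the constant `c` costs only a factor `D`, which turns into an additive
    -- constant after the second logarithm.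
    have h3 : Real.log S - Real.log c ≤ D * Real.log S := by
      have : -Real.log c ≤ -Real.log c / δ * Real.log S := by
        rw [div_mul_eq_mul_div, le_div_iff₀ hδ]
        exact mul_le_mul_of_nonneg_left hS (by linarith)
      rw [hD]
      have e1 : (1 - Real.log c / δ) * Real.log S =
        Real.log S + -Real.log c / δ * Real.log S := by ring
      linarith
    have hL0 : 0 < Real.logb S n := div_pos (Real.log_pos hn1) hlS
    have h4 : Real.logb S n ≤ e * D := by
      rw [Real.logb, div_le_iff₀ hlS]
      calc Real.log n ≤ e * (Real.log S - Real.log c) := h2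
        _ ≤ e * (D * Real.log S) := by gcongr
        _ = _ := by ring
    have h5 : Real.logb 2 (Real.logb S n) ≤ 4 * ((T : ℝ) / n) + 2 + Real.logb 2 D := by
      calc _ ≤ Real.logb 2 (e * D) := Real.logb_le_logb_of_le (by norm_num) hL0 h4
        _ = _ := by
          rw [Real.logb_mul he0.ne' (by linarith), he, Real.logb_rpow (by norm_num) (by norm_num)]
    have h6 : 0.25 * n * Real.logb 2 (Real.logb S n) ≤
        0.25 * n * (4 * ((T : ℝ) / n) + 2 + Real.logb 2 D) := by gcongr
    have h7 : 0.25 * n * (4 * ((T : ℝ) / n) + 2 + Real.logb 2 D) =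
        T + (0.5 + 0.25 * Real.logb 2 D) * n := by
      field_simp
      ring
    linarith

end BranchingProgram

/-- The program need only be correct on lists of pairwise distinct integers. The constants are
absolute: they depend on none of `n`, `k`, `T` and the program. -/
theorem mainTheorem1 :
    ∃ (c : ℝ) (a : ℕ) (C : ℝ), 0 < c ∧
      ∀ (n r : ℕ), 2 ≤ n → IsMedianRank n r →
      ∀ B : BranchingProgram n (UpTo (2 * n)) Bool, B.Oblivious →
      (∀ x : Fin n → UpTo (2 * n), Function.Injective x → B.Outputs x (medianBit r x)) →
      ∀ T : ℕ, B.RunsInTime T →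
        (∀ k : ℝ, (T : ℝ) ≤ k * n →
          (2 : ℝ) ^ (c * (n : ℝ) ^ ((1 : ℝ) / (2 : ℝ) ^ (4 * k + 2)) / (Real.logb 2 n) ^ a)
            ≤ (B.size : ℝ)) ∧
        (0.25 * n * Real.logb 2 (Real.logb B.space n) - C * n ≤ (T : ℝ)) := by
  have hl3 : 1 < Real.logb 2 3 := by
    rw [Real.lt_logb_iff_rpow_lt (by norm_num) (by norm_num)]
    norm_num
  refine ⟨1 / 240, 0, 0.5 + 0.25 * Real.logb 2
    (1 - Real.log (1 / 240) / Real.log (Real.logb 2 3)), by norm_num, ?_⟩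
  intro n r hn hr B hobl hB T hT
  have hsize := BranchingProgram.two_le_size hr hn B hB
  have hsize0 : (0 : ℝ) < B.size := by exact_mod_cast (by omega : 0 < B.size)
  constructor
  · intro k hk
    rw [pow_zero, div_one, ← Real.le_logb_iff_rpow_le (by norm_num) hsize0]
    exact BranchingProgram.rpow_le_space hn hr B hobl hB hT hk
  · have hn0 : (n : ℝ) ≠ 0 := by positivity
    -- The size is an integer, so a space above `1` is at least `logb 2 3`; this keeps `log S` away
    -- from `0`.
    have hspace : B.space = 1 ∨ Real.logb 2 3 ≤ B.space := by
      rcases hsize.eq_or_lt with h | h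
      · left
        rw [BranchingProgram.space, ← h]
        exact Real.logb_self_eq_one (by norm_num)
      · right
        exact Real.logb_le_logb_of_le (by norm_num) (by norm_num) (by exact_mod_cast h)
    refine BranchingProgram.time_bound hn (by norm_num) (by norm_num) (Real.log_pos hl3) ?_ ?_
      (BranchingProgram.rpow_le_space hn hr B hobl hB hT (div_mul_cancel₀ _ hn0).ge)
    · exact hspace.imp_right fun h => Real.log_le_log (by linarith) h
    · rcases hspace with h | h <;> linarith
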